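/- Let $V$ be a Hausdorff $C^\infty$ manifold of finite dimension $m\ge 1$, possibly with boundary (not necessarily paracompact or connected). Let $G$ be a connected Hausdorff Lie group of positive or infinite dimension, modelled on a sequentially complete Hausdorff locally convex real vector space, with smoothness understood in the Michal–Bastiani sense. Assume that $G$ is locally exponential: it has a $C^\infty$ exponential map $\exp_G:\mathfrak g\to G$ that maps some open neighbourhood of $0$ in the Lie algebra $\mathfrak g$ diffeomorphically onto an open neighbourhood of $\mathbf 1\in G$. Let $\mathcal F$ be one of the following smoothness classes: - $C^k$ in the Michal–Bastiani sense, $k\in\{0,1,\dots,\infty\}$; - if $G$ is a Banach Lie group, $C^k$ in the sense of Fréchet differentiability, $k\in\{0,1,\dots,\infty\}$; - if $\dim G<\infty$, locally Hölder $C^{k,\alpha}$, $k\in\{0,1,\dots\}$, $0\le\alpha\le 1$, where $C^{k,0}=C^k$; - if $\dim G<\infty$, locally Sobolev $W^{k,p}$, $k\in\{1,2,\dots\}$, $1\le p<\infty$, with $kp>m$, or with $k=m$ and $p=1$. Let $\mathcal F(V,G)$ be the group, under pointwise multiplication, of all continuous maps $V\to G$ of class $\mathcal F$. Let $\mathcal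 F_c(V,G)$ be the subgroup of those $x\in\mathcal F(V,G)$ that are equal to $\mathbf 1$ outside a compact subset of $V$. Let $\mathcal F_c^0(V,G)$ be the normal subgroup of all $x\in\mathcal F(V,G)$ for which there are a compact set $K\subset V$ with $\operatorname{supp}x\subset K$ and a homotopy $H:[0,1]\times V\to G$ relative to $V\setminus K$ such that $H(0,\cdot)\equiv\mathbf 1$, $H(1,\cdot)=x$ and $H(t,\cdot)\in\mathcal F(V,G)$ for all $t\in[0,1]$. For $x\in\mathcal F(V,G)$ let $[x]$ be the coset of $\mathcal F_c^0(V,G)$ containing $x$, and let $Z(G)$ be the center of $G$. Let $f:\mathcal F(V,G)\to G$ (respectively $f:\mathcal F_c(V,G)\to G$) be a group homomorphism, and suppose that there is a point $v_0\in V$ such that $f(x)=x(v_0)$ for all $x\in\mathcal F_c^0(V,G)$. Then there is a group homomorphism $\psi:\mathcal F(V,G)/\mathcal F_c^0(V,G)\to Z(G)$ (respectively $\psi:\mathcal F_c(V,G)/\mathcal F_c^0(V,G)\to Z(G)$) such that $$f(x)=\psi([x])\,x(v_0)\qquad\text{for all }x\in\mathcal F(V,G)\ (\text{respectively }x\in\mathcal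 F_c(V,G)).$$ -/

import Mathlib

open Set Filter Topology MeasureTheory
open scoped Manifold ContDiff NNReal

universe u

/-- Sequential completeness of a topological vector space: every Cauchy sequence converges. -/
def SeqComplete (E : Type*) [AddCommGroup E] [TopologicalSpace E] : Prop :=
  ∀ u : ℕ → E, (∀ W ∈ 𝓝 (0 : E), ∃ N : ℕ, ∀ i ≥ N, ∀ j ≥ N, u i - u j ∈ W) →
    ∃ a : E, Tendsto u atTop (𝓝 a)

section MichalBastiani

variable {E F : Type*} [AddCommGroup E] [Module ℝ E] [TopologicalSpace E]
  [AddCommGroup F] [Module ℝ F] [TopologicalSpace F]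

/-- `f` has directional derivative `f'` at `x` in the direction `h`:
`(f (x + t h) - f x) / t → f'` as `t → 0`, `t ≠ 0`. -/
def HasDirDeriv (f : E → F) (f' : F) (x h : E) : Prop :=
  Tendsto (fun t : ℝ => t⁻¹ • (f (x + t • h) - f x)) (𝓝[≠] (0 : ℝ)) (𝓝 f')

/-- `f` is `C^k` in the Michal-Bastiani sense on `U`: all iterated directional derivatives
`D j x (h₁, …, hⱼ)`, `j ≤ k`, of `f` exist and are jointly continuous on `U × E^j`.
For open `U` this is literally the usual definition. It is also used for sets `U` contained in
the closure of their interior (relatively open subsets of a half-space), where, as usual, the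
derivatives are taken at interior points and have to extend continuously to `U × E^j`. -/
def MBContDiffOn (k : ℕ∞) (f : E → F) (U : Set E) : Prop :=
  ∃ D : (j : ℕ) → E → (Fin j → E) → F,
    (∀ x ∈ U, ∀ h : Fin 0 → E, D 0 x h = f x) ∧
    (∀ j : ℕ, (j : ℕ∞) ≤ k →
      ContinuousOn (fun q : E × (Fin j → E) => D j q.1 q.2) (U ×ˢ (univ : Set (Fin j → E)))) ∧
    (∀ j : ℕ, (j : ℕ∞) < k → ∀ x ∈ interior U, ∀ (h : Fin j → E) (h' : E),
      HasDirDeriv (fun y => D j y h) (D (j + 1) x (Fin.snoc (α := fun _ => E) h h')) x h')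

end MichalBastiani

section LieGroups

variable (E : Type*) [AddCommGroup E] [Module ℝ E] [TopologicalSpace E]
  (G : Type*) [TopologicalSpace G] [ChartedSpace E G] [Group G]

/-- `G` is a Lie group modelled on the topological vector space `E`: the changes of charts, the
multiplication and the inversion are smooth in the Michal-Bastiani sense. -/
class MBLieGroup : Prop extends IsTopologicalGroup G where
  smooth_transition : ∀ ψ ∈ atlas E G, ∀ χ ∈ atlas E G,
    MBContDiffOn ⊤ (fun a : E => χ (ψ.symm a)) {a | a ∈ ψ.target ∧ ψ.symm a ∈ χ.source}
  smooth_mul : ∀ ψ₁ ∈ atlas E G, ∀ ψ₂ ∈ atlas E G, ∀ χ ∈ atlas E G,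
    MBContDiffOn ⊤ (fun a : E × E => χ (ψ₁.symm a.1 * ψ₂.symm a.2))
      {a | a.1 ∈ ψ₁.target ∧ a.2 ∈ ψ₂.target ∧ ψ₁.symm a.1 * ψ₂.symm a.2 ∈ χ.source}
  smooth_inv : ∀ ψ ∈ atlas E G, ∀ χ ∈ atlas E G,
    MBContDiffOn ⊤ (fun a : E => χ ((ψ.symm a)⁻¹))
      {a | a ∈ ψ.target ∧ (ψ.symm a)⁻¹ ∈ χ.source}

variable {E G}

/-- `ex` is the exponential map of `G`. The Lie algebra `T₁G` is identified with the model space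
`E` by the differential at `1` of the preferred chart at `1`. The map `ex` is smooth, and for all
`a` the curve `t ↦ ex (t a)` is a one-parameter subgroup with velocity `a` at `t = 0`. -/
structure IsLieExp (ex : E → G) : Prop where
  continuous : Continuous ex
  smooth : ∀ χ ∈ atlas E G, MBContDiffOn ⊤ (fun a : E => χ (ex a)) (ex ⁻¹' χ.source)
  map_add_smul : ∀ (a : E) (s t : ℝ), ex ((s + t) • a) = ex (s • a) * ex (t • a)
  velocity : ∀ a : E, HasDirDeriv (fun b : E => chartAt E (1 : G) (ex b)) a 0 a

variable (E G)

/-- `G` is locally exponential: it has a smooth exponential map that sends some open neighbourhood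
of `0` diffeomorphically onto an open neighbourhood of `1`. -/
def LocallyExponential : Prop :=
  ∃ ex : E → G, IsLieExp ex ∧
    ∃ U : Set E, IsOpen U ∧ (0 : E) ∈ U ∧ IsOpen (ex '' U) ∧
      ∃ lg : G → E, (∀ a ∈ U, lg (ex a) = a) ∧ ContinuousOn lg (ex '' U) ∧
        ∀ χ ∈ atlas E G,
          MBContDiffOn ⊤ (fun b : E => lg (χ.symm b)) {b | b ∈ χ.target ∧ χ.symm b ∈ ex '' U}

end LieGroups

section Sobolev

variable {m d : ℕ}

/-- `g` is the weak partial derivative `∂_{s 0} ⋯ ∂_{s (j-1)} u` on the open set `Ω ⊆ ℝ^m`. -/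
def IsWeakPartial (Ω : Set (EuclideanSpace ℝ (Fin m))) {j : ℕ} (s : Fin j → Fin m)
    (u g : EuclideanSpace ℝ (Fin m) → EuclideanSpace ℝ (Fin d)) : Prop :=
  ∀ η : EuclideanSpace ℝ (Fin m) → ℝ, ContDiff ℝ ∞ η → HasCompactSupport η → tsupport η ⊆ Ω →
    ∫ z in Ω, iteratedFDeriv ℝ j η z (fun i => EuclideanSpace.single (s i) (1 : ℝ)) • u z
      = (-1 : ℝ) ^ j • ∫ z in Ω, η z • g z

/-- `u ∈ W^{k,p}(Ω)`: `u` has weak partial derivatives of all orders `≤ k` (the order `0` one being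
`u` itself), and these belong to `L^p(Ω)`. -/
def MemSobolev (k : ℕ) (p : ℝ) (Ω : Set (EuclideanSpace ℝ (Fin m)))
    (u : EuclideanSpace ℝ (Fin m) → EuclideanSpace ℝ (Fin d)) : Prop :=
  MemLp u (ENNReal.ofReal p) (volume.restrict Ω) ∧
    ∀ j : ℕ, j ≤ k → ∀ s : Fin j → Fin m,
      ∃ g : EuclideanSpace ℝ (Fin m) → EuclideanSpace ℝ (Fin d),
        MemLp g (ENNReal.ofReal p) (volume.restrict Ω) ∧ IsWeakPartial Ω s u g

end Sobolev

/-- The smoothness classes of maps from an `m`-dimensional manifold to a manifold modelled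
on `E`. For the class of `C^k` maps in the sense of Fréchet, `E` has to be a Banach space up to
isomorphism of topological vector spaces. For the Hölder and Sobolev classes, `E` has to be finite
dimensional. None of the classes depends on the choice of the isomorphism `e`. -/
inductive SmoothnessClass (m : ℕ) (E : Type u) [AddCommGroup E] [Module ℝ E]
    [TopologicalSpace E] : Type (u + 1)
  /-- `C^k` in the Michal-Bastiani sense, `0 ≤ k ≤ ∞` -/
  | michalBastiani (k : ℕ∞)
  /-- `C^k` in the sense of Fréchet, `0 ≤ k ≤ ∞` -/
  | frechet (k : ℕ∞) (B : Type u) [NormedAddCommGroup B] [NormedSpace ℝ B] [CompleteSpace B]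
      (e : E ≃L[ℝ] B)
  /-- locally Hölder `C^{k,α}`, `k = 0, 1, …`, `0 ≤ α ≤ 1` -/
  | holder (k : ℕ) (α : ℝ≥0) (hα : α ≤ 1) (d : ℕ) (e : E ≃L[ℝ] EuclideanSpace ℝ (Fin d))
  /-- locally Sobolev `W^{k,p}`, `k = 1, 2, …`, `1 ≤ p < ∞`, with `k p > m`, or `k = m`, `p = 1` -/
  | sobolev (k : ℕ) (p : ℝ) (hk : 1 ≤ k) (hp : 1 ≤ p)
      (hkp : (m : ℝ) < k * p ∨ (k = m ∧ p = 1))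
      (d : ℕ) (e : E ≃L[ℝ] EuclideanSpace ℝ (Fin d))

/-- The continuous map `u : U → E` is of class `c` on the relatively open subset `U` of the closed
half-space in `ℝ^m`. -/
def SmoothnessClass.HoldsOn {m : ℕ} {E : Type u} [AddCommGroup E] [Module ℝ E]
    [TopologicalSpace E] (c : SmoothnessClass m E) (u : EuclideanSpace ℝ (Fin m) → E)
    (U : Set (EuclideanSpace ℝ (Fin m))) : Prop :=
  match c with
  | .michalBastiani k => MBContDiffOn k u U
  | @SmoothnessClass.frechet _ _ _ _ _ k _ _ _ _ e => ContDiffOn ℝ k (fun z => e (u z)) U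
  | .holder k α _ _ e => ContDiffOn ℝ k (fun z => e (u z)) U ∧
      ∃ C : ℝ≥0, HolderOnWith C α (iteratedFDerivWithin ℝ k (fun z => e (u z)) U) U
  | .sobolev k p _ _ _ _ e => MemSobolev k p (interior U) (fun z => e (u z))

section MappingGroups

variable {m : ℕ} [NeZero m] {E : Type u} [AddCommGroup E] [Module ℝ E] [TopologicalSpace E]
  (c : SmoothnessClass m E)
  (V : Type*) [TopologicalSpace V] [ChartedSpace (EuclideanHalfSpace m) V]
  (G : Type*) [TopologicalSpace G] [ChartedSpace E G]

variable {V G} in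
/-- `x : V → G` is a map of class `c`: it is continuous, and in charts it is of class `c` on some
(relatively open) neighbourhood of each point. -/
def IsMapOfClass (x : V → G) : Prop :=
  Continuous x ∧
    ∀ φ ∈ atlas (EuclideanHalfSpace m) V, ∀ χ ∈ atlas E G, ∀ v ∈ φ.source, x v ∈ χ.source →
      ∃ O : Set (EuclideanSpace ℝ (Fin m)), IsOpen O ∧ φ.extend (𝓡∂ m) v ∈ O ∧
        (∀ z ∈ O ∩ range (𝓡∂ m), z ∈ (φ.extend (𝓡∂ m)).target ∧
          x ((φ.extend (𝓡∂ m)).symm z) ∈ χ.source) ∧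
        c.HoldsOn (fun z => χ (x ((φ.extend (𝓡∂ m)).symm z))) (O ∩ range (𝓡∂ m))

variable [Group G]

/-- The group `𝓕(V, G)` of all maps `V → G` of class `c`, under pointwise multiplication.
(For a Lie group `G` the maps of class `c` are closed under products and inverses, so that this
group consists precisely of these maps; see `mem_mapGroup_iff`. Taking the generated subgroup
makes the group structure available without a proof of that fact for all classes.) -/
def mapGroup : Subgroup (V → G) :=
  Subgroup.closure {x | IsMapOfClass c x}

theorem mem_mapGroup_iff (h1 : IsMapOfClass c (1 : V → G))
    (hmul : ∀ x y : V → G, IsMapOfClass c x → IsMapOfClass c y → IsMapOfClass c (x * y))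
    (hinv : ∀ x : V → G, IsMapOfClass c x → IsMapOfClass c x⁻¹) (x : V → G) :
    x ∈ mapGroup c V G ↔ IsMapOfClass c x := by
  refine ⟨fun hx => ?_, fun hx => Subgroup.subset_closure hx⟩
  refine Subgroup.closure_induction (p := fun y _ => IsMapOfClass c y) (fun y hy => hy) h1
    (fun y z _ _ hy hz => hmul y z hy hz) (fun y _ hy => hinv y hy) hx

variable [IsTopologicalGroup G]

theorem continuous_of_mem_mapGroup {x : V → G} (hx : x ∈ mapGroup c V G) : Continuous x := by
  refine Subgroup.closure_induction (p := fun y _ => Continuous y) (fun y hy => hy.1)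
    continuous_const (fun y z _ _ hy hz => hy.mul hz) (fun y _ hy => hy.inv) hx

/-- The group `𝓕_c(V, G)` of the elements of `𝓕(V, G)` that are `1` outside a compact set. -/
def compactMapGroup : Subgroup (V → G) where
  carrier := {x | x ∈ mapGroup c V G ∧ ∃ K : Set V, IsCompact K ∧ ∀ v ∉ K, x v = 1}
  one_mem' := ⟨one_mem _, ∅, isCompact_empty, fun _ _ => rfl⟩
  mul_mem' := by
    rintro x y ⟨hx, K, hK, hxK⟩ ⟨hy, L, hL, hyL⟩
    refine ⟨mul_mem hx hy, K ∪ L, hK.union hL, fun v hv => ?_⟩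
    simp only [mem_union, not_or] at hv
    simp [hxK v hv.1, hyL v hv.2]
  inv_mem' := by
    rintro x ⟨hx, K, hK, hxK⟩
    exact ⟨inv_mem hx, K, hK, fun v hv => by simp [hxK v hv]⟩

/-- The group `𝓕_c⁰(V, G)` of the maps `x` for which there are a compact set `K ⊆ V` and a
homotopy `H : [0, 1] × V → G` relative to `V \ K` from the constant map `1` to `x`, with
`H (t, ·) ∈ 𝓕(V, G)` for all `t`. (As `H (0, ·) = 1`, the homotopy is relative to `V \ K` if and
only if `H (t, v) = 1` for all `t` and all `v ∉ K`; in particular `x` is supported in `K`.) -/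
def nullMapGroup : Subgroup (V → G) where
  carrier := {x | ∃ K : Set V, IsCompact K ∧ ∃ H : unitInterval × V → G, Continuous H ∧
    (∀ v, H (0, v) = 1) ∧ (∀ v, H (1, v) = x v) ∧ (∀ t, ∀ v ∉ K, H (t, v) = 1) ∧
    ∀ t, (fun v => H (t, v)) ∈ mapGroup c V G}
  one_mem' := ⟨∅, isCompact_empty, fun _ => 1, continuous_const, fun _ => rfl, fun _ => rfl,
    fun _ _ _ => rfl, fun _ => one_mem _⟩
  mul_mem' := by
    rintro x y ⟨K, hK, H, hH, h0, h1, hr, hm⟩ ⟨L, hL, I, hI, i0, i1, ir, im⟩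
    refine ⟨K ∪ L, hK.union hL, fun q => H q * I q, hH.mul hI, fun v => by simp [h0, i0],
      fun v => by simp [h1, i1], fun t v hv => ?_, fun t => mul_mem (hm t) (im t)⟩
    simp only [mem_union, not_or] at hv
    simp [hr t v hv.1, ir t v hv.2]
  inv_mem' := by
    rintro x ⟨K, hK, H, hH, h0, h1, hr, hm⟩
    exact ⟨K, hK, fun q => (H q)⁻¹, hH.inv, fun v => by simp [h0], fun v => by simp [h1],
      fun t v hv => by simp [hr t v hv], fun t => inv_mem (hm t)⟩

theorem nullMapGroup_conj {x y : V → G} (hx : x ∈ mapGroup c V G) (hy : y ∈ nullMapGroup c V G) :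
    x * y * x⁻¹ ∈ nullMapGroup c V G := by
  obtain ⟨K, hK, H, hH, h0, h1, hr, hm⟩ := hy
  have hc : Continuous fun q : unitInterval × V => x q.2 :=
    (continuous_of_mem_mapGroup c V G hx).comp continuous_snd
  exact ⟨K, hK, fun q => x q.2 * H q * (x q.2)⁻¹, (hc.mul hH).mul hc.inv,
    fun v => by simp [h0], fun v => by simp [h1], fun t v hv => by simp [hr t v hv],
    fun t => mul_mem (mul_mem hx (hm t)) (inv_mem hx)⟩

theorem nullMapGroup_le : nullMapGroup c V G ≤ compactMapGroup c V G := by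
  rintro x ⟨K, hK, H, -, -, h1, hr, hm⟩
  have hx : (fun v => H (1, v)) = x := funext h1
  exact ⟨hx ▸ hm 1, K, hK, fun v hv => by rw [← h1 v, hr 1 v hv]⟩

/-- `𝓕_c⁰(V, G)` as a subgroup of `𝓕(V, G)` is normal. -/
instance nullMapGroup_normal : ((nullMapGroup c V G).subgroupOf (mapGroup c V G)).Normal where
  conj_mem _ hy x := nullMapGroup_conj c V G x.2 hy

/-- `𝓕_c⁰(V, G)` as a subgroup of `𝓕_c(V, G)` is normal. -/
instance nullMapGroup_normal' :
    ((nullMapGroup c V G).subgroupOf (compactMapGroup c V G)).Normal where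
  conj_mem _ hy x := nullMapGroup_conj c V G x.2.1 hy

end MappingGroups

/-! Write `p` for evaluation at `v₀`. Suppose `p` maps the normal subgroup of null-homotopic maps
onto `G`. Given `x` and `g`, choose a null-homotopic `y` with `p (x * y * x⁻¹) = g`. Since `f` and
`p` agree on `y` and on its conjugate, `f x * (p x)⁻¹` commutes with `g`. This quotient is therefore
central, hence multiplicative in `x`, and it is trivial on the normal subgroup
(`MonoidHom.exists_center_factor`).

Surjectivity (`exists_nullMapGroup_eval_eq`): for a bump function `θ` at `v₀`, the map `v ↦ ex (θ v
• a)` has value `ex a` at `v₀` and is contracted to `1` by `ex (t • θ v • a)`. The values at `v₀`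
thus form a subgroup containing the neighbourhood `ex '' U` of `1`, which is all of the connected
group `G`.

The analytic work is to show that these maps belong to every smoothness class. In charts they are a
smooth curve `χ (ex (s • a))` composed with a smooth real function, so only one-variable calculus in
`E` is needed (`SmoothnessClass.exists_holdsOn_curve_comp`). -/

/-! ### Calculus of curves in a topological vector space -/

section DirectionalDerivatives

variable {F : Type*} [AddCommGroup F] [Module ℝ F] [TopologicalSpace F]

/-- Chain rule for the composition of a curve in a topological vector space with a real function
of one variable. -/
theorem HasDirDeriv.comp_real [ContinuousSMul ℝ F] {γ : ℝ → F} {v : F} {σ : ℝ → ℝ}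
    {σ' : ℝ} (hγ : HasDirDeriv γ v (σ 0) 1) (hσ : HasDerivAt σ σ' 0) :
    Tendsto (fun t : ℝ => t⁻¹ • (γ (σ t) - γ (σ 0))) (𝓝[≠] 0) (𝓝 (σ' • v)) := by
  classical
  -- The difference quotient, completed by its limit at `0`; this avoids dividing by `σ t - σ 0`,
  -- which may vanish for `t ≠ 0`.
  set Q : ℝ → F := Function.update (fun s => s⁻¹ • (γ (σ 0 + s) - γ (σ 0))) 0 v with hQ
  have hQc : ContinuousAt Q 0 := by
    rw [hQ, continuousAt_update_same]
    simpa [HasDirDeriv] using hγ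
  have hQe : ∀ s, γ (σ 0 + s) - γ (σ 0) = s • Q s := by
    intro s
    by_cases hs : s = 0
    · simp [hs]
    · simp [hQ, Function.update_of_ne hs, smul_smul, mul_inv_cancel₀ hs]
  have hσt : Tendsto (fun t : ℝ => t⁻¹ • (σ t - σ 0)) (𝓝[≠] 0) (𝓝 σ') := by
    simpa using hasDerivAt_iff_tendsto_slope_zero.1 hσ
  have hσc : Tendsto (fun t : ℝ => σ t - σ 0) (𝓝[≠] 0) (𝓝 0) := by
    have := (hσ.continuousAt.tendsto.sub_const (σ 0)).mono_left
      (nhdsWithin_le_nhds (s := ({0}ᶜ : Set ℝ)))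
    simpa using this
  have hQt : Tendsto (fun t : ℝ => Q (σ t - σ 0)) (𝓝[≠] 0) (𝓝 v) := by
    have : Q 0 = v := by simp [hQ]
    exact this ▸ hQc.tendsto.comp hσc
  refine (hσt.smul hQt).congr fun t => ?_
  rw [smul_assoc, ← hQe, add_sub_cancel]

/-- Product rule for a real function and a curve in a topological vector space. -/
theorem tendsto_slope_smul [ContinuousAdd F] [ContinuousSMul ℝ F]
    {p : ℝ → ℝ} {p' : ℝ} {g : ℝ → F} {g' : F} (hp : HasDerivAt p p' 0)
    (hgc : ContinuousAt g 0)
    (hg : Tendsto (fun t : ℝ => t⁻¹ • (g t - g 0)) (𝓝[≠] 0) (𝓝 g')) :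
    Tendsto (fun t : ℝ => t⁻¹ • (p t • g t - p 0 • g 0)) (𝓝[≠] 0) (𝓝 (p' • g 0 + p 0 • g')) := by
  have hpt : Tendsto (fun t : ℝ => t⁻¹ • (p t - p 0)) (𝓝[≠] 0) (𝓝 p') := by
    simpa using hasDerivAt_iff_tendsto_slope_zero.1 hp
  have hgt : Tendsto g (𝓝[≠] 0) (𝓝 (g 0)) := hgc.tendsto.mono_left nhdsWithin_le_nhds
  refine ((hpt.smul hgt).add (hg.const_smul (p 0))).congr fun t => ?_
  rw [smul_assoc, sub_smul, smul_comm (p 0), ← smul_add, smul_sub (p 0)]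
  congr 1
  abel

/-- For curves in a normed space directional derivatives are ordinary ones; this bridges to the
Fréchet, Hölder and Sobolev classes. -/
theorem ContDiffOn.of_hasDirDeriv {B : Type*} [NormedAddCommGroup B] [NormedSpace ℝ B]
    {γ : ℕ → ℝ → B} {J : Set ℝ} (hJ : IsOpen J)
    (hd : ∀ i, ∀ s ∈ J, HasDirDeriv (γ i) (γ (i + 1) s) s 1) :
    ContDiffOn ℝ ∞ (γ 0) J := by
  have hd' : ∀ i, ∀ s ∈ J, HasDerivAt (γ i) (γ (i + 1) s) s := by
    intro i s hs
    rw [hasDerivAt_iff_tendsto_slope_zero]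
    simpa [HasDirDeriv] using hd i s hs
  rw [contDiffOn_infty]
  intro n
  suffices ∀ (n i : ℕ), ContDiffOn ℝ n (γ i) J from this n 0
  intro n
  induction n with
  | zero =>
    intro i
    exact contDiffOn_zero.2 fun s hs => (hd' i s hs).continuousAt.continuousWithinAt
  | succ n ih =>
    intro i
    push_cast
    rw [contDiffOn_succ_iff_deriv_of_isOpen hJ]
    refine ⟨fun s hs => (hd' i s hs).differentiableAt.differentiableWithinAt, by simp,
      (ih (i + 1)).congr fun s hs => (hd' i s hs).deriv⟩

end DirectionalDerivatives

/-! ### Faà di Bruno's formula for a curve after a real function -/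

section Composition

variable {X : Type*} [NormedAddCommGroup X] [NormedSpace ℝ X]

/-- The coefficients in the formula of Faà di Bruno: the `j`-th iterated directional derivative of
`γ ∘ τ` at `z` in the directions `h` is `∑ i, compCoeff W τ j i (z, h) • γ⁽ⁱ⁾ (τ z)`. -/
noncomputable def compCoeff (W : Set X) (τ : X → ℝ) : (j i : ℕ) → X × (Fin j → X) → ℝ
  | 0, 0, _ => 1
  | 0, _ + 1, _ => 0
  -- The direction `(·, 0)` moves only the base point; the earlier directions stay frozen, and the
  -- newest one is the last entry.
  | j + 1, 0, q => fderivWithin ℝ (compCoeff W τ j 0) (W ×ˢ univ)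
      (q.1, Fin.init (α := fun _ => X) q.2) (q.2 (Fin.last j), 0)
  | j + 1, i + 1, q => fderivWithin ℝ (compCoeff W τ j (i + 1)) (W ×ˢ univ)
      (q.1, Fin.init (α := fun _ => X) q.2) (q.2 (Fin.last j), 0) +
      compCoeff W τ j i (q.1, Fin.init (α := fun _ => X) q.2) *
        fderivWithin ℝ τ W q.1 (q.2 (Fin.last j))

/-- Each differentiation raises the order of the derivative of `γ` by at most one. -/
theorem compCoeff_eq_zero (W : Set X) (τ : X → ℝ) {j i : ℕ} (h : j < i) :
    compCoeff W τ j i = 0 := by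
  induction j generalizing i with
  | zero =>
    obtain ⟨i, rfl⟩ := Nat.exists_eq_add_of_lt h
    funext q
    simp [compCoeff]
  | succ j ih =>
    obtain ⟨i, rfl⟩ : ∃ l, i = l + 1 := ⟨i - 1, by omega⟩
    funext q
    simp [compCoeff, ih (i := i) (by omega), ih (i := i + 1) (by omega)]

theorem contDiffOn_compCoeff {W : Set X} {τ : X → ℝ} (hW : UniqueDiffOn ℝ W)
    (hτ : ContDiffOn ℝ ∞ τ W) (j i : ℕ) :
    ContDiffOn ℝ ∞ (compCoeff W τ j i) (W ×ˢ univ) := by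
  induction j generalizing i with
  | zero =>
    cases i
    · exact contDiffOn_const.congr fun _ _ => by rw [compCoeff]
    · exact contDiffOn_const.congr fun _ _ => by rw [compCoeff]
  | succ j ih =>
    have hu : UniqueDiffOn ℝ (W ×ˢ (univ : Set (Fin j → X))) := hW.prod uniqueDiffOn_univ
    have hi : ContDiff ℝ ∞ fun q : X × (Fin (j + 1) → X) =>
        (q.1, Fin.init (α := fun _ => X) q.2) := by
      unfold Fin.init
      fun_prop
    have hl : ContDiff ℝ ∞ fun q : X × (Fin (j + 1) → X) => q.2 (Fin.last j) := by fun_prop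
    have hm : MapsTo (fun q : X × (Fin (j + 1) → X) => (q.1, Fin.init (α := fun _ => X) q.2))
        (W ×ˢ univ) (W ×ˢ univ) := fun q hq => ⟨hq.1, mem_univ _⟩
    have h1 : ∀ i, ContDiffOn ℝ ∞ (fun q : X × (Fin (j + 1) → X) =>
        fderivWithin ℝ (compCoeff W τ j i) (W ×ˢ univ)
          (q.1, Fin.init (α := fun _ => X) q.2) (q.2 (Fin.last j), 0)) (W ×ˢ univ) := fun i =>
      (((ih i).fderivWithin hu (m := ∞) (by simp)).comp hi.contDiffOn hm).clm_apply
        (hl.prodMk contDiff_const).contDiffOn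
    cases i with
    | zero => exact (h1 0).congr fun _ _ => by rw [compCoeff]
    | succ i =>
      refine ((h1 (i + 1)).add (((ih i).comp hi.contDiffOn hm).mul
        (((hτ.fderivWithin hW (m := ∞) (by simp)).comp contDiff_fst.contDiffOn
          fun q hq => hq.1).clm_apply hl.contDiffOn))).congr fun q _ => ?_
      rw [compCoeff]
      rfl

variable {F : Type*} [AddCommGroup F] [Module ℝ F] [TopologicalSpace F]
  [IsTopologicalAddGroup F] [ContinuousSMul ℝ F]

/-- The composition of a smooth curve in a topological vector space with a smooth real function
is smooth in the Michal-Bastiani sense. -/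
theorem MBContDiffOn.curve_comp {γ : ℕ → ℝ → F} {J : Set ℝ} (hJ : IsOpen J)
    (hc : ∀ i, ContinuousOn (γ i) J)
    (hd : ∀ i, ∀ s ∈ J, HasDirDeriv (γ i) (γ (i + 1) s) s 1)
    {W : Set X} (hW : UniqueDiffOn ℝ W) {τ : X → ℝ} (hτ : ContDiffOn ℝ ∞ τ W)
    (hτJ : MapsTo τ W J) (k : ℕ∞) : MBContDiffOn k (fun z => γ 0 (τ z)) W := by
  refine ⟨fun j z h => ∑ i ∈ Finset.range (j + 1), compCoeff W τ j i (z, h) • γ i (τ z),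
    ?_, ?_, ?_⟩
  · intro z _ h
    simp [compCoeff]
  · intro j _
    refine continuousOn_finsetSum _ fun i _ => ?_
    exact (contDiffOn_compCoeff hW hτ j i).continuousOn.smul ((hc i).comp
      (hτ.continuousOn.comp continuousOn_fst fun q hq => hq.1) fun q hq => hτJ hq.1)
  · intro j _ z hz h h'
    have hzW : W ∈ 𝓝 z := mem_interior_iff_mem_nhds.1 hz
    have hzW' : z ∈ W := interior_subset hz
    have hline : HasDerivAt (fun t : ℝ => z + t • h') h' 0 := by
      simpa using ((hasDerivAt_id (0 : ℝ)).smul_const h').const_add z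
    have hz0 : z + (0 : ℝ) • h' = z := by simp
    have hσ : HasDerivAt (fun t : ℝ => τ (z + t • h')) (fderivWithin ℝ τ W z h') 0 := by
      have h1 : HasFDerivAt τ (fderivWithin ℝ τ W z) (z + (0 : ℝ) • h') := by
        rw [hz0]
        exact ((hτ.differentiableOn (by simp) z hzW').hasFDerivWithinAt).hasFDerivAt hzW
      exact h1.comp_hasDerivAt _ hline
    have hp : ∀ i, HasDerivAt (fun t : ℝ => compCoeff W τ j i (z + t • h', h))
        (fderivWithin ℝ (compCoeff W τ j i) (W ×ˢ univ) (z, h) (h', 0)) 0 := by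
      intro i
      have h1 : HasFDerivAt (compCoeff W τ j i)
          (fderivWithin ℝ (compCoeff W τ j i) (W ×ˢ univ) (z, h)) (z + (0 : ℝ) • h', h) := by
        rw [hz0]
        refine (((contDiffOn_compCoeff hW hτ j i).differentiableOn (by simp) (z, h)
          ⟨hzW', mem_univ _⟩).hasFDerivWithinAt).hasFDerivAt (prod_mem_nhds hzW univ_mem)
      exact h1.comp_hasDerivAt _ (hline.prodMk (hasDerivAt_const _ _))
    have hterm : ∀ i, Tendsto (fun t : ℝ => t⁻¹ • (compCoeff W τ j i (z + t • h', h) •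
        γ i (τ (z + t • h')) - compCoeff W τ j i (z, h) • γ i (τ z))) (𝓝[≠] 0)
        (𝓝 (fderivWithin ℝ (compCoeff W τ j i) (W ×ˢ univ) (z, h) (h', 0) • γ i (τ z) +
          compCoeff W τ j i (z, h) • fderivWithin ℝ τ W z h' • γ (i + 1) (τ z))) := by
      intro i
      have hz1 : τ (z + (0 : ℝ) • h') ∈ J := by rw [hz0]; exact hτJ hzW'
      have hg := HasDirDeriv.comp_real (hd i _ hz1) hσ
      have hgc : ContinuousAt (fun t : ℝ => γ i (τ (z + t • h'))) 0 :=
        ContinuousAt.comp (g := γ i) ((hc i).continuousAt (hJ.mem_nhds hz1)) hσ.continuousAt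
      have := tendsto_slope_smul (hp i) hgc hg
      simpa only [hz0] using this
    have hsum := tendsto_finsetSum (Finset.range (j + 1)) fun i _ => hterm i
    unfold HasDirDeriv
    convert hsum using 1
    · funext t
      rw [← Finset.smul_sum, Finset.sum_sub_distrib]
    · congr 1
      -- The coefficient of index `j + 1` vanishes, so the first sum can be extended by one term;
      -- shifting the index in the other sum then gives the recursion of `compCoeff`.
      have htop : fderivWithin ℝ (compCoeff W τ j (j + 1)) (W ×ˢ univ) (z, h) (h', 0) = 0 := by
        rw [compCoeff_eq_zero W τ (Nat.lt_succ_self j)]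
        simp
      have hext : ∑ i ∈ Finset.range (j + 1),
          fderivWithin ℝ (compCoeff W τ j i) (W ×ˢ univ) (z, h) (h', 0) • γ i (τ z) =
          ∑ i ∈ Finset.range (j + 1 + 1),
            fderivWithin ℝ (compCoeff W τ j i) (W ×ˢ univ) (z, h) (h', 0) • γ i (τ z) := by
        rw [Finset.sum_range_succ _ (j + 1), htop, zero_smul, add_zero]
      beta_reduce
      rw [Finset.sum_add_distrib, hext, Finset.sum_range_succ' _ (j + 1),
        Finset.sum_range_succ' _ (j + 1), add_right_comm, ← Finset.sum_add_distrib]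
      simp only [compCoeff, Fin.init_snoc, Fin.snoc_last, add_smul, mul_smul]

end Composition

/-! ### Weak derivatives of smooth functions -/

section WeakDerivatives

variable {m d : ℕ}

local notation "ℝm" => EuclideanSpace ℝ (Fin m)
local notation "ℝd" => EuclideanSpace ℝ (Fin d)

/-- Nothing is known about `u` off `Ω`, but there `η` vanishes, so the product is continuous
everywhere. -/
theorem integrable_smul_of_tsupport_subset {Ω : Set ℝm} (hΩ : IsOpen Ω) {η : ℝm → ℝ}
    (hη : Continuous η) (hs : HasCompactSupport η) (hsub : tsupport η ⊆ Ω) {u : ℝm → ℝd}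
    (hu : ContinuousOn u Ω) : Integrable (fun z => η z • u z) := by
  refine Continuous.integrable_of_hasCompactSupport ?_ (hs.smul_right (f' := u))
  refine continuous_of_tsupport fun z hz => hη.continuousAt.smul
    (hu.continuousAt (hΩ.mem_nhds (hsub (closure_mono ?_ hz))))
  exact Function.support_smul_subset_left η u

theorem setIntegral_smul_eq_integral {Ω : Set ℝm} {η : ℝm → ℝ} (hsub : tsupport η ⊆ Ω)
    (u : ℝm → ℝd) : ∫ z in Ω, η z • u z = ∫ z, η z • u z := by
  refine setIntegral_eq_integral_of_forall_compl_eq_zero fun z hz => ?_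
  rw [image_eq_zero_of_notMem_tsupport fun h => hz (hsub h), zero_smul]

/-- A function that is smooth on a set `W` has smooth weak partial derivatives of all orders on
the open subsets of `W`. -/
theorem exists_isWeakPartial {W : Set ℝm} (hW : UniqueDiffOn ℝ W) {j : ℕ}
    (s : Fin j → Fin m) {u : ℝm → ℝd} (hu : ContDiffOn ℝ ∞ u W) :
    ∃ g : ℝm → ℝd, ContDiffOn ℝ ∞ g W ∧
      ∀ Ω : Set ℝm, IsOpen Ω → Ω ⊆ W → IsWeakPartial Ω s u g := by
  induction j generalizing u with
  | zero => exact ⟨u, hu, fun Ω _ _ η _ _ _ => by simp⟩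
  | succ j ih =>
    -- The outermost derivative `∂_{s 0}` is moved from `ζ`, the remaining `j`-th derivative of `η`,
    -- onto `u` by one integration by parts; induction handles the rest.
    obtain ⟨g, hg, hgw⟩ := ih (Fin.tail s) (u := fun z =>
      fderivWithin ℝ u W z (EuclideanSpace.single (s 0) (1 : ℝ)))
      ((hu.fderivWithin hW (m := ∞) (by simp)).clm_apply contDiffOn_const)
    refine ⟨g, hg, fun Ω hΩ hΩW η hη hηs hηΩ => ?_⟩
    set e : Fin (j + 1) → ℝm := fun i => EuclideanSpace.single (s i) (1 : ℝ) with he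
    set ζ : ℝm → ℝ := fun z => iteratedFDeriv ℝ j η z (Fin.tail e) with hζ
    have hζc : ContDiff ℝ ∞ ζ := by
      have h1 : ContDiff ℝ ∞ (iteratedFDeriv ℝ j η) := hη.iteratedFDeriv_right (by
        exact_mod_cast le_top)
      exact (ContinuousMultilinearMap.apply ℝ (fun _ : Fin j => ℝm) ℝ (Fin.tail e)).contDiff.comp h1
    have hζη : tsupport ζ ⊆ tsupport η := by
      refine closure_minimal (fun z hz => ?_) (isClosed_tsupport η)
      refine support_iteratedFDeriv_subset (𝕜 := ℝ) j fun h0 => hz ?_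
      simp [hζ, h0]
    have hζs : HasCompactSupport ζ := hηs.of_isClosed_subset (isClosed_tsupport ζ) hζη
    have hζΩ : tsupport ζ ⊆ Ω := hζη.trans hηΩ
    have hd : ∀ z, iteratedFDeriv ℝ (j + 1) η z e = fderiv ℝ ζ z (e 0) := by
      intro z
      have h1 : DifferentiableAt ℝ (iteratedFDeriv ℝ j η) z :=
        (hη.differentiable_iteratedFDeriv (by exact_mod_cast ENat.natCast_lt_top j)) z
      rw [iteratedFDeriv_succ_apply_left, hζ]
      have := (ContinuousMultilinearMap.apply ℝ (fun _ : Fin j => ℝm) ℝ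
        (Fin.tail e)).hasFDerivAt.comp z h1.hasFDerivAt
      erw [this.fderiv]
      rfl
    have hdζ : ContDiff ℝ ∞ fun z => fderiv ℝ ζ z (e 0) :=
      (hζc.fderiv_right (m := ∞) (by simp)).clm_apply contDiff_const
    have hdζsub : tsupport (fun z => fderiv ℝ ζ z (e 0)) ⊆ tsupport ζ := by
      refine closure_minimal (fun z hz => ?_) (isClosed_tsupport ζ)
      refine support_fderiv_subset ℝ fun h0 => hz ?_
      simp [h0]
    have hdiff : ∀ z ∈ Ω, HasFDerivAt u (fderivWithin ℝ u W z) z := fun z hz =>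
      (hu.differentiableOn (by simp) z (hΩW hz)).hasFDerivWithinAt.hasFDerivAt
        (mem_of_superset (hΩ.mem_nhds hz) hΩW)
    have hu' : ContinuousOn (fun z => fderivWithin ℝ u W z (e 0)) Ω :=
      ((hu.continuousOn_fderivWithin hW (by simp)).clm_apply continuousOn_const).mono hΩW
    have heq : ∀ z, ζ z • fderiv ℝ u z (e 0) = ζ z • fderivWithin ℝ u W z (e 0) := by
      intro z
      by_cases hz : z ∈ tsupport ζ
      · rw [(hdiff z (hζΩ hz)).fderiv]
      · rw [image_eq_zero_of_notMem_tsupport hz, zero_smul, zero_smul]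
    have hibp := integral_smul_fderiv_eq_neg_fderiv_smul_of_integrable (μ := volume)
      (f := ζ) (g := u) (v := e 0)
      (integrable_smul_of_tsupport_subset hΩ hdζ.continuous
        (hζs.of_isClosed_subset (isClosed_tsupport _) hdζsub) (hdζsub.trans hζΩ)
        (hu.continuousOn.mono hΩW))
      (by
        simp only [heq]
        exact integrable_smul_of_tsupport_subset hΩ hζc.continuous hζs hζΩ hu')
      (integrable_smul_of_tsupport_subset hΩ hζc.continuous hζs hζΩ (hu.continuousOn.mono hΩW))
      (fun z _ => hζc.differentiable (by simp) z)
      (fun z hz => (hdiff z (hζΩ hz)).differentiableAt)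
    simp only [heq] at hibp
    have hw := hgw Ω hΩ hΩW η hη hηs hηΩ
    change ∫ z in Ω, ζ z • fderivWithin ℝ u W z (e 0) = _ at hw
    rw [setIntegral_smul_eq_integral hζΩ] at hw
    simp only [hd]
    rw [setIntegral_smul_eq_integral (hdζsub.trans hζΩ), ← neg_eq_iff_eq_neg.2 hibp, hw, pow_succ]
    simp

/-- A function that is smooth on a neighbourhood of `Ω` in `W` belongs to all Sobolev spaces
on `Ω`. -/
theorem memSobolev_of_contDiffOn {W : Set ℝm} (hW : UniqueDiffOn ℝ W) {K Ω : Set ℝm}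
    (hK : IsCompact K) (hKW : K ⊆ W) (hΩ : IsOpen Ω) (hΩK : Ω ⊆ K) {u : ℝm → ℝd}
    (hu : ContDiffOn ℝ ∞ u W) (k : ℕ) (p : ℝ) : MemSobolev k p Ω u := by
  have hmem : ∀ g : ℝm → ℝd, ContinuousOn g W →
      MemLp g (ENNReal.ofReal p) (volume.restrict Ω) := by
    intro g hg
    have : IsFiniteMeasure (volume.restrict Ω) :=
      isFiniteMeasure_restrict.2 ((measure_mono hΩK).trans_lt hK.measure_lt_top).ne
    obtain ⟨C, hC⟩ := hK.exists_bound_of_continuousOn (hg.mono hKW)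
    refine MemLp.of_bound ((hg.mono (hΩK.trans hKW)).aestronglyMeasurable hΩ.measurableSet) C ?_
    exact (ae_restrict_mem hΩ.measurableSet).mono fun z hz => hC z (hΩK hz)
  refine ⟨hmem u hu.continuousOn, fun j _ s => ?_⟩
  obtain ⟨g, hg, hgw⟩ := exists_isWeakPartial hW s hu
  exact ⟨g, hmem g hg.continuousOn, hgw Ω hΩ (hΩK.trans hKW)⟩

end WeakDerivatives

/-! ### Membership in each smoothness class -/

/-- The composition of a smooth curve in `E` with a smooth real function on a relatively open
subset of a half-space is locally of every smoothness class. -/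
theorem SmoothnessClass.exists_holdsOn_curve_comp {m : ℕ} [NeZero m] {E : Type u}
    [AddCommGroup E] [Module ℝ E] [TopologicalSpace E] [IsTopologicalAddGroup E]
    [ContinuousSMul ℝ E] (c : SmoothnessClass m E) {γ : ℕ → ℝ → E} {J : Set ℝ} (hJ : IsOpen J)
    (hc : ∀ i, ContinuousOn (γ i) J)
    (hd : ∀ i, ∀ s ∈ J, HasDirDeriv (γ i) (γ (i + 1) s) s 1)
    {O : Set (EuclideanSpace ℝ (Fin m))} (hO : IsOpen O) {τ : EuclideanSpace ℝ (Fin m) → ℝ}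
    (hτ : ContDiffOn ℝ ∞ τ (O ∩ range (𝓡∂ m))) (hτJ : MapsTo τ (O ∩ range (𝓡∂ m)) J)
    {z₀ : EuclideanSpace ℝ (Fin m)} (hz₀ : z₀ ∈ O) (hz₀' : z₀ ∈ range (𝓡∂ m)) :
    ∃ O' ⊆ O, IsOpen O' ∧ z₀ ∈ O' ∧
      c.HoldsOn (fun z => γ 0 (τ z)) (O' ∩ range (𝓡∂ m)) := by
  have hW : UniqueDiffOn ℝ (O ∩ range (𝓡∂ m)) := by
    rw [inter_comm]
    exact (𝓡∂ m).uniqueDiffOn.inter hO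
  have hnormed : ∀ {B : Type u} [NormedAddCommGroup B] [NormedSpace ℝ B] (e : E →L[ℝ] B),
      ContDiffOn ℝ ∞ (fun z => e (γ 0 (τ z))) (O ∩ range (𝓡∂ m)) := by
    intro B _ _ e
    refine (ContDiffOn.of_hasDirDeriv (γ := fun i s => e (γ i s)) hJ fun i s hs => ?_).comp hτ hτJ
    refine ((e.continuous.tendsto _).comp (hd i s hs)).congr fun t => ?_
    simp
  -- Repeated because `EuclideanSpace ℝ (Fin d)` lives in `Type`, not in `Type u`.
  have hnormed' : ∀ {d : ℕ} (e : E ≃L[ℝ] EuclideanSpace ℝ (Fin d)),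
      ContDiffOn ℝ ∞ (fun z => e (γ 0 (τ z))) (O ∩ range (𝓡∂ m)) := by
    intro d e
    refine (ContDiffOn.of_hasDirDeriv (γ := fun i s => e (γ i s)) hJ fun i s hs => ?_).comp hτ hτJ
    refine ((e.continuous.tendsto _).comp (hd i s hs)).congr fun t => ?_
    simp
  cases c with
  | michalBastiani k =>
    exact ⟨O, subset_rfl, hO, hz₀, MBContDiffOn.curve_comp hJ hc hd hW hτ hτJ k⟩
  | frechet k B e =>
    exact ⟨O, subset_rfl, hO, hz₀, (hnormed (e : E →L[ℝ] B)).of_le (by exact_mod_cast le_top)⟩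
  | holder k α hα d e =>
    have hs := hnormed' e
    -- Differentiability within the whole half-space, which is convex, gives a local Lipschitz
    -- bound.
    have h1 : ContDiffWithinAt ℝ 1 (iteratedFDerivWithin ℝ k (fun z => e (γ 0 (τ z)))
        (O ∩ range (𝓡∂ m))) (range (𝓡∂ m)) z₀ := by
      have := (hs z₀ ⟨hz₀, hz₀'⟩).iteratedFDerivWithin_right (m := 1) (i := k) hW
        (by exact_mod_cast le_top) ⟨hz₀, hz₀'⟩
      rw [inter_comm] at this ⊢
      exact (contDiffWithinAt_inter (hO.mem_nhds hz₀)).1 this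
    obtain ⟨C, t, ht, hL⟩ := h1.exists_lipschitzOnWith (𝓡∂ m).convex_range
    obtain ⟨O₁, hO₁, hz₁, hO₁t⟩ := mem_nhdsWithin.1 ht
    -- Radius `1 / 2` keeps distances at most `1`, where a Lipschitz bound implies an `α`-Hölder
    -- bound since `α ≤ 1`.
    set O' := O ∩ O₁ ∩ Metric.ball z₀ (1 / 2) with hO'
    have hOo : IsOpen O' := (hO.inter hO₁).inter Metric.isOpen_ball
    have hsub : O' ⊆ O := fun z hz => hz.1.1
    refine ⟨O', hsub, hOo, ⟨⟨hz₀, hz₁⟩, Metric.mem_ball_self (by norm_num)⟩,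
      (hs.mono (inter_subset_inter_left _ hsub)).of_le (by exact_mod_cast le_top), C, ?_⟩
    have heq : ∀ z ∈ O', iteratedFDerivWithin ℝ k (fun z => e (γ 0 (τ z)))
        (O' ∩ range (𝓡∂ m)) z = iteratedFDerivWithin ℝ k (fun z => e (γ 0 (τ z)))
        (O ∩ range (𝓡∂ m)) z := by
      intro z hz
      refine iteratedFDerivWithin_congr_set ?_ k
      filter_upwards [hOo.mem_nhds hz] with y hy
      exact propext ⟨fun h => ⟨hsub hy, h.2⟩, fun h => ⟨hy, h.2⟩⟩
    intro y hy z hz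
    rw [heq y hy.1, heq z hz.1]
    refine (hL (hO₁t ⟨hy.1.1.2, hy.2⟩) (hO₁t ⟨hz.1.1.2, hz.2⟩)).trans ?_
    gcongr
    have hyz : edist y z ≤ 1 := by
      rw [edist_dist, ENNReal.ofReal_le_one]
      have h2 := Metric.mem_ball.1 hy.1.2
      have h3 := Metric.mem_ball'.1 hz.1.2
      linarith [dist_triangle y z₀ z]
    calc edist y z = edist y z ^ (1 : ℝ) := (ENNReal.rpow_one _).symm
      _ ≤ edist y z ^ (α : ℝ) := ENNReal.rpow_le_rpow_of_exponent_ge hyz (by exact_mod_cast hα)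
  | sobolev k p hk hp hkp d e =>
    -- The closed ball meets the half-space in a compact subset of the domain, so all derivatives
    -- are bounded there and hence in `L^p`.
    obtain ⟨r, hr, hrO⟩ := Metric.nhds_basis_closedBall.mem_iff.1 (hO.mem_nhds hz₀)
    refine ⟨Metric.ball z₀ r, Metric.ball_subset_closedBall.trans hrO, Metric.isOpen_ball,
      Metric.mem_ball_self hr, ?_⟩
    exact memSobolev_of_contDiffOn hW
      ((isCompact_closedBall z₀ r).inter_right (𝓡∂ m).isClosed_range)
      (inter_subset_inter_left _ hrO) isOpen_interior
      (interior_subset.trans (inter_subset_inter_left _ Metric.ball_subset_closedBall))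
      (hnormed' e) k p

/-! ### One-parameter subgroups in charts -/

section Exponential

variable {E : Type u} [AddCommGroup E] [Module ℝ E] [TopologicalSpace E]
  {G : Type*} [TopologicalSpace G] [ChartedSpace E G] [Group G]

theorem IsLieExp.map_zero {ex : E → G} (hex : IsLieExp ex) : ex 0 = 1 := by
  have h := hex.map_add_smul 0 0 0
  simpa using h

/-- The derivatives of a one-parameter subgroup, read in a chart. -/
theorem IsLieExp.exists_deriv_curve [ContinuousSMul ℝ E] {ex : E → G} (hex : IsLieExp ex)
    {χ : OpenPartialHomeomorph G E} (hχ : χ ∈ atlas E G) (a : E) :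
    ∃ γ : ℕ → ℝ → E, (γ 0 = fun s => χ (ex (s • a))) ∧
      (∀ i, ContinuousOn (γ i) {s | ex (s • a) ∈ χ.source}) ∧
      ∀ i, ∀ s ∈ {s : ℝ | ex (s • a) ∈ χ.source}, HasDirDeriv (γ i) (γ (i + 1) s) s 1 := by
  obtain ⟨D, hD0, hDc, hDd⟩ := hex.smooth χ hχ
  have hJ : IsOpen {s : ℝ | ex (s • a) ∈ χ.source} :=
    χ.open_source.preimage (hex.continuous.comp (by fun_prop))
  have hc : ∀ i, ContinuousOn (fun s : ℝ => D i (s • a) fun _ => a)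
      {s | ex (s • a) ∈ χ.source} := by
    intro i
    have hcont : Continuous fun s : ℝ => (s • a, fun _ : Fin i => a) := by fun_prop
    exact (hDc i le_top).comp hcont.continuousOn fun s hs => ⟨hs, mem_univ _⟩
  have hd : ∀ i, ∀ s ∈ {s : ℝ | ex (s • a) ∈ χ.source},
      HasDirDeriv (fun s : ℝ => D i (s • a) fun _ => a) (D (i + 1) (s • a) fun _ => a) s 1 := by
    intro i s hs
    have hint : s • a ∈ interior (ex ⁻¹' χ.source) := by
      rw [(χ.open_source.preimage hex.continuous).interior_eq]
      exact hs
    have h := hDd i (ENat.natCast_lt_top i) (s • a) hint (fun _ => a) a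
    have hsn : (Fin.snoc (α := fun _ => E) (fun _ : Fin i => a) a) = fun _ => a := by
      funext l
      refine Fin.lastCases ?_ (fun l => ?_) l <;> simp
    rw [hsn] at h
    refine h.congr fun t => ?_
    simp [add_smul]
  -- `D 0` agrees with `χ ∘ ex` only on `ex ⁻¹' χ.source`, so the term of index `0` is replaced by
  -- the actual curve.
  refine ⟨fun i => Nat.casesOn i (fun s => χ (ex (s • a))) fun i s => D (i + 1) (s • a) fun _ => a,
    rfl, fun i => ?_, fun i s hs => ?_⟩
  · cases i with
    | zero => exact (hc 0).congr fun s hs => (hD0 _ hs _).symm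
    | succ i => exact hc (i + 1)
  · cases i with
    | zero =>
      refine (hd 0 s hs).congr' ?_
      have ht : Tendsto (fun t : ℝ => s + t • (1 : ℝ)) (𝓝[≠] 0) (𝓝 s) := by
        have : Continuous fun t : ℝ => s + t • (1 : ℝ) := by fun_prop
        simpa using (this.tendsto 0).mono_left (nhdsWithin_le_nhds (s := ({0}ᶜ : Set ℝ)))
      filter_upwards [ht.eventually (hJ.mem_nhds hs)] with t hst
      rw [hD0 _ hst, hD0 _ hs]
      rfl
    | succ i => exact hd (i + 1) s hs

end Exponential

/-! ### Exponentials of scalar functions -/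

section BumpMaps

variable {m : ℕ} [NeZero m] {E : Type u} [AddCommGroup E] [Module ℝ E] [TopologicalSpace E]
  [IsTopologicalAddGroup E] [ContinuousSMul ℝ E]
  {V : Type*} [TopologicalSpace V] [ChartedSpace (EuclideanHalfSpace m) V]
  [IsManifold (𝓡∂ m) ∞ V]
  {G : Type*} [TopologicalSpace G] [ChartedSpace E G] [Group G]

/-- A smooth real function `θ` on `V` and an element `a` of the Lie algebra give rise to a map
`v ↦ ex (θ v • a)` of every smoothness class. -/
theorem isMapOfClass_exp_smul (c : SmoothnessClass m E) {ex : E → G} (hex : IsLieExp ex)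
    {θ : V → ℝ} (hθ : ContMDiff (𝓡∂ m) 𝓘(ℝ, ℝ) ∞ θ) (a : E) :
    IsMapOfClass c fun v => ex (θ v • a) := by
  have hx : Continuous fun v => ex (θ v • a) :=
    hex.continuous.comp (hθ.continuous.smul continuous_const)
  refine ⟨hx, fun φ hφ χ hχ v hv hxv => ?_⟩
  obtain ⟨γ, hγ0, hγc, hγd⟩ := hex.exists_deriv_curve hχ a
  have hJ : IsOpen {s : ℝ | ex (s • a) ∈ χ.source} :=
    χ.open_source.preimage (hex.continuous.comp (by fun_prop))
  -- `(𝓡∂ m).symm` is defined and continuous on all of `ℝ^m`, so `O` is open there and not just in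
  -- the half-space.
  set O : Set (EuclideanSpace ℝ (Fin m)) := (𝓡∂ m).symm ⁻¹' (φ.target ∩ φ.symm ⁻¹'
    ((fun v => ex (θ v • a)) ⁻¹' χ.source)) with hOdef
  have hO : IsOpen O := (φ.isOpen_inter_preimage_symm (χ.open_source.preimage hx)).preimage
    (𝓡∂ m).continuous_symm
  have htarget : ∀ z ∈ O ∩ range (𝓡∂ m), z ∈ (φ.extend (𝓡∂ m)).target := by
    intro z hz
    rw [OpenPartialHomeomorph.extend_target]
    exact ⟨hz.1.1, hz.2⟩
  have hvO : φ.extend (𝓡∂ m) v ∈ O := by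
    simp only [hOdef, mem_preimage, OpenPartialHomeomorph.extend_coe, Function.comp_apply,
      ModelWithCorners.left_inv, mem_inter_iff]
    refine ⟨φ.map_source hv, ?_⟩
    rw [φ.left_inv hv]
    exact hxv
  have hτ : ContDiffOn ℝ ∞ (fun z => θ ((φ.extend (𝓡∂ m)).symm z)) (O ∩ range (𝓡∂ m)) := by
    rw [← contMDiffOn_iff_contDiffOn]
    refine (hθ.comp_contMDiffOn (contMDiffOn_extend_symm
      (IsManifold.subset_maximalAtlas (n := ∞) hφ))).mono fun z hz => ?_
    exact ⟨(𝓡∂ m).symm z, hz.1.1, (𝓡∂ m).right_inv hz.2⟩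
  obtain ⟨O', hO'O, hO', hvO', hh⟩ := c.exists_holdsOn_curve_comp hJ hγc hγd hO hτ
    (fun z hz => hz.1.2) hvO ⟨φ v, rfl⟩
  refine ⟨O', hO', hvO', fun z hz => ⟨htarget z ⟨hO'O hz.1, hz.2⟩, (hO'O hz.1).2⟩, ?_⟩
  rwa [hγ0] at hh

end BumpMaps

/-! ### Surjectivity of evaluation at a point -/

section Evaluation

variable {m : ℕ} [NeZero m] {E : Type u} [AddCommGroup E] [Module ℝ E] [TopologicalSpace E]
  [IsTopologicalAddGroup E] [ContinuousSMul ℝ E]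
  {V : Type*} [TopologicalSpace V] [T2Space V] [ChartedSpace (EuclideanHalfSpace m) V]
  [IsManifold (𝓡∂ m) ∞ V]
  {G : Type*} [TopologicalSpace G] [ChartedSpace E G] [Group G] [IsTopologicalGroup G]

/-- Scaling the exponent of a bump map by `t` contracts it to `1` inside the compact support of the
bump function. -/
theorem exists_nullMapGroup_eval_eq_exp (c : SmoothnessClass m E) {ex : E → G}
    (hex : IsLieExp ex) (v₀ : V) (a : E) : ∃ y ∈ nullMapGroup c V G, y v₀ = ex a := by
  obtain ⟨θ⟩ : Nonempty (SmoothBumpFunction (𝓡∂ m) v₀) := inferInstance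
  have hθ : Continuous θ := θ.continuous
  refine ⟨fun v => ex (θ v • a), ⟨tsupport θ, θ.hasCompactSupport,
    fun q => ex (θ q.2 • (q.1 : ℝ) • a), ?_, ?_, ?_, ?_, fun t => ?_⟩, by simp⟩
  · exact hex.continuous.comp (by fun_prop)
  · simp [hex.map_zero]
  · simp
  · intro t v hv
    simp [image_eq_zero_of_notMem_tsupport hv, hex.map_zero]
  · exact Subgroup.subset_closure (isMapOfClass_exp_smul c hex θ.contMDiff ((t : ℝ) • a))

/-- The evaluation at a point maps `𝓕_c⁰(V, G)` onto `G`. -/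
theorem exists_nullMapGroup_eval_eq [ConnectedSpace G] (hG : LocallyExponential E G)
    (c : SmoothnessClass m E) (v₀ : V) (g : G) : ∃ y ∈ nullMapGroup c V G, y v₀ = g := by
  obtain ⟨ex, hex, U, -, hU0, hUo, -⟩ := hG
  let S : Subgroup G := (nullMapGroup c V G).map (Pi.evalMonoidHom (fun _ => G) v₀)
  have hS : ex '' U ⊆ S := by
    rintro _ ⟨a, -, rfl⟩
    exact exists_nullMapGroup_eval_eq_exp c hex v₀ a
  -- A subgroup that is a neighbourhood of one of its points is open, hence also closed.
  have hSo : IsOpen (S : Set G) := S.isOpen_of_mem_nhds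
    (mem_of_superset (hUo.mem_nhds (mem_image_of_mem ex hU0)) hS)
  have hSu : (S : Set G) = univ :=
    IsClopen.eq_univ ⟨S.isClosed_of_isOpen hSo, hSo⟩ ⟨1, S.one_mem⟩
  have hg : g ∈ (S : Set G) := hSu ▸ mem_univ g
  exact hg

end Evaluation

/-! ### The group-theoretic argument and the theorem -/

/-- Let `p` and `f` be homomorphisms `A → G` that agree on a normal subgroup `N`, and suppose that
`p` maps `N` onto `G`. Then `f` and `p` differ by a homomorphism from `A ⧸ N` to the center. -/
theorem MonoidHom.exists_center_factor {A G : Type*} [Group A] [Group G] (N : Subgroup A)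
    [N.Normal] (p f : A →* G) (hp : ∀ g : G, ∃ y ∈ N, p y = g) (hf : ∀ y ∈ N, f y = p y) :
    ∃ ψ : A ⧸ N →* Subgroup.center G, ∀ x, f x = (ψ (QuotientGroup.mk x) : G) * p x := by
  have hz : ∀ x, f x * (p x)⁻¹ ∈ Subgroup.center G := by
    intro x
    rw [Subgroup.mem_center_iff]
    intro g
    -- Conjugating by `p x` in advance makes `p (x * y * x⁻¹) = g`.
    obtain ⟨y, hy, hyg⟩ := hp ((p x)⁻¹ * g * p x)
    have h := hf _ (Subgroup.Normal.conj_mem ‹_› y hy x)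
    simp only [map_mul, map_inv, hf y hy, hyg] at h
    calc g * (f x * (p x)⁻¹)
        = p x * ((p x)⁻¹ * g * p x) * (p x)⁻¹ * f x * (p x)⁻¹ := by group
      _ = f x * (p x)⁻¹ * g := by
        rw [← h]
        group
  let φ : A →* Subgroup.center G :=
    { toFun := fun x => ⟨f x * (p x)⁻¹, hz x⟩
      map_one' := by simp
      map_mul' := by
        intro x y
        refine Subtype.ext ?_
        -- Multiplicativity needs only that the factor of `y` commutes with `(p x)⁻¹`.
        have h := Subgroup.mem_center_iff.1 (hz y) (p x)⁻¹
        simp only [map_mul, mul_inv_rev, Subgroup.coe_mul]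
        calc f x * f y * ((p y)⁻¹ * (p x)⁻¹) = f x * (f y * (p y)⁻¹ * (p x)⁻¹) := by group
          _ = f x * (p x)⁻¹ * (f y * (p y)⁻¹) := by rw [← h, mul_assoc (f x)] }
  refine ⟨QuotientGroup.lift N φ fun y hy => ?_, fun x => ?_⟩
  · rw [MonoidHom.mem_ker]
    exact Subtype.ext (by simp [φ, hf y hy])
  · change f x = f x * (p x)⁻¹ * p x
    group

theorem theorem2p1
    {E : Type u} [AddCommGroup E] [Module ℝ E] [TopologicalSpace E] [IsTopologicalAddGroup E]
    [ContinuousSMul ℝ E] [LocallyConvexSpace ℝ E] [T2Space E] [Nontrivial E]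
    (hE : SeqComplete E)
    {G : Type*} [TopologicalSpace G] [T2Space G] [ConnectedSpace G] [ChartedSpace E G] [Group G]
    [MBLieGroup E G] (hG : LocallyExponential E G)
    {m : ℕ} [NeZero m]
    {V : Type*} [TopologicalSpace V] [T2Space V] [ChartedSpace (EuclideanHalfSpace m) V]
    [IsManifold (𝓡∂ m) ∞ V]
    (c : SmoothnessClass m E) (v₀ : V) :
    (∀ f : mapGroup c V G →* G,
      (∀ x : mapGroup c V G, (x : V → G) ∈ nullMapGroup c V G → f x = (x : V → G) v₀) →
      ∃ ψ : mapGroup c V G ⧸ (nullMapGroup c V G).subgroupOf (mapGroup c V G)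
          →* Subgroup.center G,
        ∀ x : mapGroup c V G,
          f x = (ψ (QuotientGroup.mk x) : G) * (x : V → G) v₀) ∧
    (∀ f : compactMapGroup c V G →* G,
      (∀ x : compactMapGroup c V G, (x : V → G) ∈ nullMapGroup c V G → f x = (x : V → G) v₀) →
      ∃ ψ : compactMapGroup c V G ⧸ (nullMapGroup c V G).subgroupOf (compactMapGroup c V G)
          →* Subgroup.center G,
        ∀ x : compactMapGroup c V G,
          f x = (ψ (QuotientGroup.mk x) : G) * (x : V → G) v₀) := by
  have : IsTopologicalGroup G := MBLieGroup.toIsTopologicalGroup E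
  have hev := exists_nullMapGroup_eval_eq (G := G) hG c v₀
  refine ⟨fun f hf => ?_, fun f hf => ?_⟩
  · refine MonoidHom.exists_center_factor ((nullMapGroup c V G).subgroupOf (mapGroup c V G))
      ((Pi.evalMonoidHom (fun _ => G) v₀).comp (mapGroup c V G).subtype) f (fun g => ?_) hf
    obtain ⟨y, hy, hyg⟩ := hev g
    exact ⟨⟨y, (nullMapGroup_le c V G hy).1⟩, hy, hyg⟩
  · refine MonoidHom.exists_center_factor ((nullMapGroup c V G).subgroupOf (compactMapGroup c V G))
      ((Pi.evalMonoidHom (fun _ => G) v₀).comp (compactMapGroup c V G).subtype) f (fun g => ?_) hf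
    obtain ⟨y, hy, hyg⟩ := hev g
    exact ⟨⟨y, nullMapGroup_le c V G hy⟩, hy, hyg⟩
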